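/- Theorem. Let $n\ge 2$ and $m\ge 0$ be integers. Let $\mathcal{E}'(\mathbb{R}^n)$ be the space of compactly supported (real- or complex-valued) distributions on $\mathbb{R}^n$, i.e. the dual of $C^\infty(\mathbb{R}^n)$. For $p\ge 0$ let $\mathcal{E}'(S^p)$ be the space of compactly supported symmetric $p$-tensor field distributions $f=(f_{i_1\cdots i_p})_{1\le i_1,\dots,i_p\le n}$, with components $f_{i_1\cdots i_p}\in\mathcal{E}'(\mathbb{R}^n)$ that are symmetric in the indices, and let $$\mathcal{E}'(\mathbf{S}^m)=\mathcal{E}'(S^0)\oplus\mathcal{E}'(S^1)\oplus\cdots\oplus\mathcal{E}'(S^m),$$ whose elements are written $F=f^{(0)}+f^{(1)}+\cdots+f^{(m)}$ with $f^{(p)}\in\mathcal{E}'(S^p)$. For every integer $k\ge 0$ the generalized momentum ray transform $I^{m,k}F\in\mathcal{D}'\big(\mathbb{R}^n\times(\mathbb{R}^n\setminus\{0\})\big)$ of $F\in\mathcal{E}'(\mathbf{S}^m)$ is the distribution defined by $$\langle I^{m,k}F,\Psi\rangle=\sum_{p=0}^{m}\ \sum_{i_1,\dots,i_p=1}^{n}\Big\langle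 f^{(p)}_{i_1\cdots i_p},\ \int_{\mathbb{R}^n}\int_{\mathbb{R}}t^k\,\xi^{i_1}\cdots\xi^{i_p}\,\Psi(x-t\xi,\xi)\,\mathrm{d}t\,\mathrm{d}\xi\Big\rangle ,\qquad \Psi\in C_c^\infty\big(\mathbb{R}^n\times(\mathbb{R}^n\setminus\{0\})\big),$$ where the double integral is a smooth function of $x\in\mathbb{R}^n$. (If all components of $F$ are smooth and compactly supported, $I^{m,k}F$ is the function $(x,\xi)\mapsto\int_{\mathbb{R}}t^k\sum_{p=0}^m\sum_{i_1,\dots,i_p} f^{(p)}_{i_1\cdots i_p}(x+t\xi)\,\xi^{i_1}\cdots\xi^{i_p}\,\mathrm{d}t$.) Let $F\in\mathcal{E}'(\mathbf{S}^m)$. If $I^{m,k}F=0$ in $\mathcal{D}'\big(\mathbb{R}^n\times(\mathbb{R}^n\setminus\{0\})\big)$ for $k=0,1,\dots,m$, then $F=0$, i.e. $f^{(p)}=0$ for all $0\le p\le m$. -/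

import Mathlib

open MeasureTheory TopologicalSpace
open scoped Distributions ContDiff

/-! ### Smooth functions and compactly supported distributions -/

/-- The space `C^∞(ℝⁿ)` of (real-valued) smooth functions. -/
def SmoothFun (n : ℕ) : Submodule ℝ (EuclideanSpace ℝ (Fin n) → ℝ) where
  carrier := {φ | ContDiff ℝ ∞ φ}
  add_mem' {φ ψ} (hφ : ContDiff ℝ ∞ φ) (hψ : ContDiff ℝ ∞ ψ) := hφ.add hψ
  zero_mem' := (contDiff_const : ContDiff ℝ ∞ fun _ => (0 : ℝ))
  smul_mem' c φ (hφ : ContDiff ℝ ∞ φ) := hφ.const_smul c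

/-- The space `ℰ'(ℝⁿ)` of compactly supported distributions with values in `𝕜`, as the dual of
`C^∞(ℝⁿ)`: the linear forms `u` for which there are a compact set `K`, an order `N` and a constant
`C` with `|u(φ)| ≤ C * sup_{j ≤ N, x ∈ K} |D^j φ(x)|` for all smooth `φ`. As for Mathlib's
`Distribution`, scalar-valued distributions are tested against real-valued functions. -/
def CompactDistribution (𝕜 : Type*) [RCLike 𝕜] (n : ℕ) :
    Submodule ℝ (SmoothFun n →ₗ[ℝ] 𝕜) where
  carrier := {u | ∃ (K : Set (EuclideanSpace ℝ (Fin n))) (N : ℕ) (C : ℝ), IsCompact K ∧ 0 ≤ C ∧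
    ∀ (φ : SmoothFun n) (B : ℝ), 0 ≤ B →
      (∀ j ≤ N, ∀ x ∈ K, ‖iteratedFDeriv ℝ j φ.1 x‖ ≤ B) → ‖u φ‖ ≤ C * B}
  add_mem' := by
    rintro u v ⟨K, N, C, hK, hC, hu⟩ ⟨K', N', C', hK', hC', hv⟩
    refine ⟨K ∪ K', max N N', C + C', hK.union hK', add_nonneg hC hC', fun φ B hB h => ?_⟩
    have h1 := hu φ B hB fun j hj x hx => h j (hj.trans (le_max_left _ _)) x (Or.inl hx)
    have h2 := hv φ B hB fun j hj x hx => h j (hj.trans (le_max_right _ _)) x (Or.inr hx)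
    rw [LinearMap.add_apply, add_mul]
    exact (norm_add_le _ _).trans (add_le_add h1 h2)
  zero_mem' := ⟨∅, 0, 0, isCompact_empty, le_rfl, fun φ B hB _ => by simp⟩
  smul_mem' := by
    rintro c u ⟨K, N, C, hK, hC, hu⟩
    refine ⟨K, N, ‖c‖ * C, hK, by positivity, fun φ B hB h => ?_⟩
    rw [LinearMap.smul_apply, norm_smul, mul_assoc]
    exact mul_le_mul_of_nonneg_left (hu φ B hB h) (norm_nonneg c)

/-- The space `ℰ'(S^p)` of compactly supported symmetric `p`-tensor field distributions on `ℝⁿ`,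
given by their components `f_{i₁ ⋯ iₚ} ∈ ℰ'(ℝⁿ)`. -/
def SymTensorDistribution (𝕜 : Type*) [RCLike 𝕜] (n p : ℕ) :
    Submodule ℝ ((Fin p → Fin n) → CompactDistribution 𝕜 n) where
  carrier := {f | ∀ (σ : Equiv.Perm (Fin p)) (i : Fin p → Fin n), f (i ∘ σ) = f i}
  add_mem' hf hg σ i := by simp only [Pi.add_apply, hf σ i, hg σ i]
  zero_mem' _ _ := rfl
  smul_mem' c f hf σ i := by simp only [Pi.smul_apply, hf σ i]

/-- The space `ℰ'(𝐒^m)` with `𝐒^m = S^0 ⊕ S^1 ⊕ ⋯ ⊕ S^m`: its elements are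
`F = f^{(0)} + f^{(1)} + ⋯ + f^{(m)}` with `f^{(p)} ∈ ℰ'(S^p)`. -/
abbrev TensorSumDistribution (𝕜 : Type*) [RCLike 𝕜] (n m : ℕ) : Type _ :=
  (p : Fin (m + 1)) → SymTensorDistribution 𝕜 n p

/-- The open set `ℝⁿ × (ℝⁿ ∖ {0})`. -/
def nonzeroDirections (n : ℕ) :
    Opens (EuclideanSpace ℝ (Fin n) × EuclideanSpace ℝ (Fin n)) :=
  ⟨{q | q.2 ≠ 0}, isOpen_ne_fun continuous_snd continuous_const⟩

/-! ### Analytic facts that make the adjoint transform well defined -/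

section RayIntegral

variable {n : ℕ} {G : Type} [NormedAddCommGroup G] [NormedSpace ℝ G]

/-- The integral `∫ a(ξ,t) g(x - tξ, ξ) d(ξ,t)` over `ℝⁿ × ℝ`. -/
noncomputable def rayIntegral (a : EuclideanSpace ℝ (Fin n) × ℝ → ℝ)
    (g : EuclideanSpace ℝ (Fin n) × EuclideanSpace ℝ (Fin n) → G)
    (x : EuclideanSpace ℝ (Fin n)) : G :=
  ∫ q : EuclideanSpace ℝ (Fin n) × ℝ, a q • g (x - q.2 • q.1, q.1)

theorem exists_compact_rays {K : Set (EuclideanSpace ℝ (Fin n) × EuclideanSpace ℝ (Fin n))}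
    (hK : IsCompact K) (hKΩ : K ⊆ nonzeroDirections n) (R : ℝ) :
    ∃ L : Set (EuclideanSpace ℝ (Fin n) × ℝ), IsCompact L ∧
      ∀ x ∈ Metric.ball (0 : EuclideanSpace ℝ (Fin n)) R, ∀ q ∉ L,
        (x - q.2 • q.1, q.1) ∉ K := by
  obtain ⟨M, hM⟩ := hK.isBounded.exists_norm_le
  obtain ⟨δ, hδ, hδK⟩ : ∃ δ : ℝ, 0 < δ ∧ ∀ q ∈ K, δ ≤ ‖q.2‖ := by
    rcases K.eq_empty_or_nonempty with rfl | hne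
    · exact ⟨1, one_pos, by simp⟩
    · obtain ⟨q₀, hq₀, hmin⟩ := hK.exists_isMinOn hne
        (f := fun q => ‖q.2‖) continuous_snd.norm.continuousOn
      have hq₀' : q₀.2 ≠ 0 := hKΩ hq₀
      exact ⟨‖q₀.2‖, norm_pos_iff.2 hq₀', fun q hq => isMinOn_iff.1 hmin q hq⟩
  refine ⟨Metric.closedBall 0 M ×ˢ Metric.closedBall 0 ((R + M) / δ),
    (isCompact_closedBall _ _).prod (isCompact_closedBall _ _), ?_⟩
  rintro x hx ⟨ξ, t⟩ hq hmem
  apply hq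
  have h := hM (x - t • ξ, ξ) hmem
  rw [Prod.norm_mk] at h
  have h1 : ‖x - t • ξ‖ ≤ M := (le_max_left _ _).trans h
  have h2 : ‖ξ‖ ≤ M := (le_max_right _ _).trans h
  have h3 : δ ≤ ‖ξ‖ := hδK (x - t • ξ, ξ) hmem
  have hx' : ‖x‖ < R := mem_ball_zero_iff.1 hx
  refine Set.mk_mem_prod (mem_closedBall_zero_iff.2 h2) (mem_closedBall_zero_iff.2 ?_)
  rw [le_div_iff₀ hδ]
  have h4 : ‖t • ξ‖ ≤ ‖x‖ + ‖x - t • ξ‖ := by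
    have h5 := norm_sub_le x (x - t • ξ)
    rwa [sub_sub_cancel] at h5
  rw [norm_smul] at h4
  calc ‖t‖ * δ ≤ ‖t‖ * ‖ξ‖ := mul_le_mul_of_nonneg_left h3 (norm_nonneg t)
    _ ≤ R + M := h4.trans (add_le_add hx'.le h1)

theorem continuous_rayIntegrand {a : EuclideanSpace ℝ (Fin n) × ℝ → ℝ} (ha : Continuous a)
    {g : EuclideanSpace ℝ (Fin n) × EuclideanSpace ℝ (Fin n) → G} (hg : Continuous g)
    (x : EuclideanSpace ℝ (Fin n)) :
    Continuous fun q : EuclideanSpace ℝ (Fin n) × ℝ => a q • g (x - q.2 • q.1, q.1) :=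
  ha.smul (hg.comp (by fun_prop))

theorem integrable_rayIntegrand {a : EuclideanSpace ℝ (Fin n) × ℝ → ℝ} (ha : Continuous a)
    {K : Set (EuclideanSpace ℝ (Fin n) × EuclideanSpace ℝ (Fin n))}
    (hK : IsCompact K) (hKΩ : K ⊆ nonzeroDirections n)
    {g : EuclideanSpace ℝ (Fin n) × EuclideanSpace ℝ (Fin n) → G} (hg : Continuous g)
    (hgK : ∀ q ∉ K, g q = 0) (x : EuclideanSpace ℝ (Fin n)) :
    Integrable fun q : EuclideanSpace ℝ (Fin n) × ℝ => a q • g (x - q.2 • q.1, q.1) := by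
  obtain ⟨L, hL, hLK⟩ := exists_compact_rays hK hKΩ (‖x‖ + 1)
  refine (continuous_rayIntegrand ha hg x).integrable_of_hasCompactSupport
    (HasCompactSupport.intro hL fun q hq => ?_)
  rw [hgK _ (hLK x (by simp) q hq), smul_zero]

/-- The partial derivative in the first variable. -/
noncomputable def fstDeriv (g : EuclideanSpace ℝ (Fin n) × EuclideanSpace ℝ (Fin n) → G) :
    EuclideanSpace ℝ (Fin n) × EuclideanSpace ℝ (Fin n) → EuclideanSpace ℝ (Fin n) →L[ℝ] G :=
  fun q => (fderiv ℝ g q).comp (ContinuousLinearMap.inl ℝ _ _)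

theorem contDiff_fstDeriv {g : EuclideanSpace ℝ (Fin n) × EuclideanSpace ℝ (Fin n) → G}
    (hg : ContDiff ℝ ∞ g) : ContDiff ℝ ∞ (fstDeriv g) :=
  (hg.fderiv_right (m := ∞) (by simp)).clm_comp contDiff_const

theorem fstDeriv_eq_zero {K : Set (EuclideanSpace ℝ (Fin n) × EuclideanSpace ℝ (Fin n))}
    (hK : IsCompact K) {g : EuclideanSpace ℝ (Fin n) × EuclideanSpace ℝ (Fin n) → G}
    (hgK : ∀ q ∉ K, g q = 0) : ∀ q ∉ K, fstDeriv g q = 0 := by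
  intro q hq
  have h : g =ᶠ[nhds q] fun _ => 0 :=
    Filter.mem_of_superset (hK.isClosed.isOpen_compl.mem_nhds hq) fun y hy => hgK y hy
  rw [fstDeriv, h.fderiv_eq]
  simp

theorem norm_iteratedFDeriv_fstDeriv_le
    {g : EuclideanSpace ℝ (Fin n) × EuclideanSpace ℝ (Fin n) → G} (hg : ContDiff ℝ ∞ g) (j : ℕ)
    (q : EuclideanSpace ℝ (Fin n) × EuclideanSpace ℝ (Fin n)) :
    ‖iteratedFDeriv ℝ j (fstDeriv g) q‖ ≤ ‖iteratedFDeriv ℝ (j + 1) g q‖ := by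
  have hinl : ‖ContinuousLinearMap.inl ℝ (EuclideanSpace ℝ (Fin n))
      (EuclideanSpace ℝ (Fin n))‖ ≤ 1 :=
    ContinuousLinearMap.opNorm_le_bound _ zero_le_one fun x => by simp
  have h := ((ContinuousLinearMap.compL ℝ (EuclideanSpace ℝ (Fin n))
    (EuclideanSpace ℝ (Fin n) × EuclideanSpace ℝ (Fin n)) G).flip
      (ContinuousLinearMap.inl ℝ _ _)).norm_iteratedFDeriv_comp_left
    (f := fderiv ℝ g) (x := q) (N := ∞) (n := j)
    (hg.fderiv_right (m := ∞) (by simp)).contDiffAt (by exact_mod_cast le_top)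
  rw [norm_iteratedFDeriv_fderiv] at h
  refine h.trans (mul_le_of_le_one_left (norm_nonneg _) ?_)
  refine ContinuousLinearMap.opNorm_le_bound _ zero_le_one fun A => ?_
  rw [one_mul]
  exact (A.opNorm_comp_le _).trans (mul_le_of_le_one_right (norm_nonneg _) hinl)

theorem hasFDerivAt_rayIntegral {a : EuclideanSpace ℝ (Fin n) × ℝ → ℝ} (ha : Continuous a)
    {K : Set (EuclideanSpace ℝ (Fin n) × EuclideanSpace ℝ (Fin n))}
    (hK : IsCompact K) (hKΩ : K ⊆ nonzeroDirections n)
    {g : EuclideanSpace ℝ (Fin n) × EuclideanSpace ℝ (Fin n) → G} (hg : ContDiff ℝ ∞ g)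
    (hgK : ∀ q ∉ K, g q = 0) (x : EuclideanSpace ℝ (Fin n)) :
    HasFDerivAt (rayIntegral a g) (rayIntegral a (fstDeriv g) x) x := by
  obtain ⟨L, hL, hLK⟩ := exists_compact_rays hK hKΩ (‖x‖ + 1)
  have hg' := (contDiff_fstDeriv hg).continuous
  have hgK' := fstDeriv_eq_zero hK hgK
  obtain ⟨C, hC⟩ := hg'.bounded_above_of_compact_support (HasCompactSupport.intro hK hgK')
  refine hasFDerivAt_integral_of_dominated_of_fderiv_le
    (F := fun x (q : EuclideanSpace ℝ (Fin n) × ℝ) => a q • g (x - q.2 • q.1, q.1))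
    (F' := fun x q => a q • fstDeriv g (x - q.2 • q.1, q.1))
    (s := Metric.ball 0 (‖x‖ + 1)) (bound := L.indicator fun q => ‖a q‖ * C)
    (Metric.isOpen_ball.mem_nhds (by simp))
    (Filter.Eventually.of_forall fun y =>
      (continuous_rayIntegrand ha hg.continuous y).aestronglyMeasurable)
    (integrable_rayIntegrand ha hK hKΩ hg.continuous hgK x)
    (continuous_rayIntegrand ha hg' x).aestronglyMeasurable
    (Filter.Eventually.of_forall fun q y hy => ?_) ?_
    (Filter.Eventually.of_forall fun q y hy => ?_)
  · by_cases hq : q ∈ L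
    · rw [Set.indicator_of_mem hq, norm_smul]
      exact mul_le_mul_of_nonneg_left (hC _) (norm_nonneg _)
    · rw [Set.indicator_of_notMem hq, hgK' _ (hLK y hy q hq), smul_zero, norm_zero]
  · rw [integrable_indicator_iff hL.measurableSet]
    exact (ha.norm.mul continuous_const).continuousOn.integrableOn_compact hL
  · have h1 : HasFDerivAt (fun y : EuclideanSpace ℝ (Fin n) => (y - q.2 • q.1, q.1))
        (ContinuousLinearMap.inl ℝ _ _) y :=
      ((hasFDerivAt_id y).sub_const _).prodMk (hasFDerivAt_const q.1 y)
    exact (((hg.differentiable (by simp)) _).hasFDerivAt.comp y h1).const_smul (a q)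

theorem contDiff_rayIntegral {a : EuclideanSpace ℝ (Fin n) × ℝ → ℝ} (ha : Continuous a)
    {K : Set (EuclideanSpace ℝ (Fin n) × EuclideanSpace ℝ (Fin n))}
    (hK : IsCompact K) (hKΩ : K ⊆ nonzeroDirections n) (j : ℕ) :
    ∀ {G : Type} [NormedAddCommGroup G] [NormedSpace ℝ G]
      {g : EuclideanSpace ℝ (Fin n) × EuclideanSpace ℝ (Fin n) → G},
      ContDiff ℝ ∞ g → (∀ q ∉ K, g q = 0) → ContDiff ℝ j (rayIntegral a g) := by
  induction j with
  | zero =>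
    intro G _ _ g hg hgK
    exact contDiff_zero.2 (continuous_iff_continuousAt.2 fun x =>
      (hasFDerivAt_rayIntegral ha hK hKΩ hg hgK x).continuousAt)
  | succ j ih =>
    intro G _ _ g hg hgK
    exact_mod_cast contDiff_succ_iff_hasFDerivAt.2 ⟨rayIntegral a (fstDeriv g),
      ih (contDiff_fstDeriv hg) (fstDeriv_eq_zero hK hgK),
      hasFDerivAt_rayIntegral ha hK hKΩ hg hgK⟩

theorem norm_iteratedFDeriv_rayIntegral_le {a : EuclideanSpace ℝ (Fin n) × ℝ → ℝ}
    (ha : Continuous a) {K : Set (EuclideanSpace ℝ (Fin n) × EuclideanSpace ℝ (Fin n))}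
    (hK : IsCompact K) (hKΩ : K ⊆ nonzeroDirections n) {R : ℝ}
    {L : Set (EuclideanSpace ℝ (Fin n) × ℝ)} (hL : IsCompact L)
    (hLK : ∀ x ∈ Metric.ball (0 : EuclideanSpace ℝ (Fin n)) R, ∀ q ∉ L,
        (x - q.2 • q.1, q.1) ∉ K) (j : ℕ) :
    ∀ {G : Type} [NormedAddCommGroup G] [NormedSpace ℝ G]
      {g : EuclideanSpace ℝ (Fin n) × EuclideanSpace ℝ (Fin n) → G} {B : ℝ},
      ContDiff ℝ ∞ g → (∀ q ∉ K, g q = 0) → (∀ q, ‖iteratedFDeriv ℝ j g q‖ ≤ B) →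
      ∀ x ∈ Metric.ball (0 : EuclideanSpace ℝ (Fin n)) R,
        ‖iteratedFDeriv ℝ j (rayIntegral a g) x‖ ≤ (∫ q in L, ‖a q‖) * B := by
  induction j with
  | zero =>
    intro G _ _ g B hg hgK hB x hx
    simp only [norm_iteratedFDeriv_zero] at hB ⊢
    have hB0 : ∀ q, ‖a q • g (x - q.2 • q.1, q.1)‖ ≤ L.indicator (fun q => ‖a q‖ * B) q := by
      intro q
      by_cases hq : q ∈ L
      · rw [Set.indicator_of_mem hq, norm_smul]
        exact mul_le_mul_of_nonneg_left (hB _) (norm_nonneg _)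
      · rw [Set.indicator_of_notMem hq, hgK _ (hLK x hx q hq), smul_zero, norm_zero]
    rw [← integral_mul_const, ← integral_indicator hL.measurableSet]
    refine norm_integral_le_of_norm_le ?_ (Filter.Eventually.of_forall hB0)
    rw [integrable_indicator_iff hL.measurableSet]
    exact (ha.norm.mul continuous_const).continuousOn.integrableOn_compact hL
  | succ j ih =>
    intro G _ _ g B hg hgK hB x hx
    rw [← norm_iteratedFDeriv_fderiv, show fderiv ℝ (rayIntegral a g) = rayIntegral a (fstDeriv g)
      from funext fun y => (hasFDerivAt_rayIntegral ha hK hKΩ hg hgK y).fderiv]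
    exact ih (contDiff_fstDeriv hg) (fstDeriv_eq_zero hK hgK)
      (fun q => (norm_iteratedFDeriv_fstDeriv_le hg j q).trans (hB q)) x hx

end RayIntegral

/-! ### Momentum ray transforms -/

section MomentumRayTransform

variable {n : ℕ}

theorem adjointMRT_eq_rayIntegral (k : ℕ) {p : ℕ} (i : Fin p → Fin n)
    (ψ : 𝓓(nonzeroDirections n, ℝ)) (x : EuclideanSpace ℝ (Fin n)) :
    ∫ ξ : EuclideanSpace ℝ (Fin n), ∫ t : ℝ, t ^ k * (∏ j, ξ (i j)) * ψ (x - t • ξ, ξ) =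
      rayIntegral (fun q => q.2 ^ k * ∏ j, q.1 (i j)) ψ x :=
  (integral_prod _ (integrable_rayIntegrand
    (a := fun q => q.2 ^ k * ∏ j, q.1 (i j)) (by fun_prop) ψ.hasCompactSupport ψ.tsupport_subset
    ψ.continuous (fun _ hq => image_eq_zero_of_notMem_tsupport hq) x)).symm

/-- The component `[(I^k)^* ψ]_{i₁ ⋯ iₚ}` of the adjoint momentum ray transform, the smooth
function `x ↦ ∫_{ℝⁿ} ∫_ℝ t^k ξ^{i₁} ⋯ ξ^{iₚ} ψ(x - tξ, ξ) dt dξ`. -/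
noncomputable def adjointMRT (k : ℕ) {p : ℕ} (i : Fin p → Fin n)
    (ψ : 𝓓(nonzeroDirections n, ℝ)) : SmoothFun n :=
  ⟨fun x => ∫ ξ : EuclideanSpace ℝ (Fin n), ∫ t : ℝ,
      t ^ k * (∏ j, ξ (i j)) * ψ (x - t • ξ, ξ), by
    rw [funext (adjointMRT_eq_rayIntegral k i ψ)]
    exact contDiff_infty.2 fun j => contDiff_rayIntegral (by fun_prop) ψ.hasCompactSupport
      ψ.tsupport_subset j ψ.contDiff fun _ hq => image_eq_zero_of_notMem_tsupport hq⟩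

theorem coe_adjointMRT (k : ℕ) {p : ℕ} (i : Fin p → Fin n) (ψ : 𝓓(nonzeroDirections n, ℝ)) :
    (adjointMRT k i ψ).1 = rayIntegral (fun q => q.2 ^ k * ∏ j, q.1 (i j)) ψ :=
  funext (adjointMRT_eq_rayIntegral k i ψ)

theorem adjointMRT_add (k : ℕ) {p : ℕ} (i : Fin p → Fin n) (ψ χ : 𝓓(nonzeroDirections n, ℝ)) :
    adjointMRT k i (ψ + χ) = adjointMRT k i ψ + adjointMRT k i χ := by
  have hint (ψ : 𝓓(nonzeroDirections n, ℝ)) (x : EuclideanSpace ℝ (Fin n)) :=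
    integrable_rayIntegrand (a := fun q => q.2 ^ k * ∏ j, q.1 (i j)) (by fun_prop)
      ψ.hasCompactSupport ψ.tsupport_subset ψ.continuous
      (fun _ hq => image_eq_zero_of_notMem_tsupport hq) x
  refine Subtype.ext (funext fun x => ?_)
  rw [Submodule.coe_add, Pi.add_apply, coe_adjointMRT, coe_adjointMRT, coe_adjointMRT]
  simp only [rayIntegral]
  rw [← integral_add (hint ψ x) (hint χ x)]
  simp [mul_add]

theorem adjointMRT_smul (k : ℕ) {p : ℕ} (i : Fin p → Fin n) (c : ℝ)
    (ψ : 𝓓(nonzeroDirections n, ℝ)) : adjointMRT k i (c • ψ) = c • adjointMRT k i ψ := by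
  refine Subtype.ext (funext fun x => ?_)
  rw [Submodule.coe_smul, Pi.smul_apply, coe_adjointMRT, coe_adjointMRT]
  simp only [rayIntegral]
  rw [← integral_smul]
  simp [mul_left_comm]

variable {𝕜 : Type*} [RCLike 𝕜]

theorem continuous_pairing_adjointMRT (k : ℕ) {p : ℕ} (i : Fin p → Fin n)
    (u : CompactDistribution 𝕜 n)
    (K : Compacts (EuclideanSpace ℝ (Fin n) × EuclideanSpace ℝ (Fin n)))
    (hK : (K : Set (EuclideanSpace ℝ (Fin n) × EuclideanSpace ℝ (Fin n))) ⊆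
      nonzeroDirections n) :
    Continuous ((fun ψ : 𝓓(nonzeroDirections n, ℝ) => u.1 (adjointMRT k i ψ)) ∘
      TestFunction.ofSupportedIn hK) := by
  obtain ⟨K', N, C, hK', hC, hu⟩ := u.2
  obtain ⟨R, hR⟩ := hK'.isBounded.subset_ball 0
  obtain ⟨L, hL, hLK⟩ := exists_compact_rays K.isCompact hK R
  refine (ContDiffMapSupportedIn.mkCLMtoNormedSpace ℝ
    (fun ψ => u.1 (adjointMRT k i (TestFunction.ofSupportedIn hK ψ))) (fun ψ χ => ?_)
    (fun c ψ => ?_) ⟨Finset.Iic N, C * ∫ q in L, ‖q.2 ^ k * ∏ j, q.1 (i j)‖, by positivity,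
      fun ψ => ?_⟩).continuous
  · rw [← map_add, ← adjointMRT_add]
    rfl
  · rw [← map_smul, ← adjointMRT_smul]
    rfl
  · rw [mul_assoc]
    refine hu _ _ (by positivity) fun j hj x hx => ?_
    rw [coe_adjointMRT]
    refine norm_iteratedFDeriv_rayIntegral_le (by fun_prop) K.isCompact hK hL hLK j ψ.contDiff
      (fun q hq => ψ.zero_on_compl hq) (fun q => ?_) x (hR hx)
    exact (ContDiffMapSupportedIn.norm_iteratedFDeriv_apply_le_seminorm_top ℝ).trans
      (Seminorm.le_finset_sup_apply
        (p := fun j => ContDiffMapSupportedIn.seminorm ℝ _ ℝ ⊤ K j) (Finset.mem_Iic.2 hj))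

/-- The contribution `ψ ↦ ⟨u, [(I^k)^* ψ]_{i₁ ⋯ iₚ}⟩` of a single component `u = f_{i₁ ⋯ iₚ}`, a
distribution on `ℝⁿ × (ℝⁿ ∖ {0})`. -/
noncomputable def componentMRT (k : ℕ) {p : ℕ} (i : Fin p → Fin n)
    (u : CompactDistribution 𝕜 n) : 𝓓'(nonzeroDirections n, 𝕜) :=
  TestFunction.mkCLM ℝ (fun ψ => u.1 (adjointMRT k i ψ))
    (fun ψ χ => by rw [adjointMRT_add, map_add])
    (fun c ψ => by rw [adjointMRT_smul, map_smul])
    (continuous_pairing_adjointMRT k i u)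

/-- The momentum ray transform `I^k f ∈ 𝓓'(ℝⁿ × (ℝⁿ ∖ {0}))` of `f ∈ ℰ'(S^p)`, that is
`⟨I^k f, ψ⟩ = ⟨f, (I^k)^* ψ⟩ = ∑_{i₁, …, iₚ} ⟨f_{i₁ ⋯ iₚ}, [(I^k)^* ψ]_{i₁ ⋯ iₚ}⟩`. -/
noncomputable def momentumRayTransform (k : ℕ) {p : ℕ} (f : SymTensorDistribution 𝕜 n p) :
    𝓓'(nonzeroDirections n, 𝕜) :=
  ∑ i : Fin p → Fin n, componentMRT k i (f.1 i)

/-- The generalized momentum ray transform `I^{m,k} F = ∑_{p ≤ m} I^k f^{(p)}` of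
`F = f^{(0)} + ⋯ + f^{(m)} ∈ ℰ'(𝐒^m)`. -/
noncomputable def generalizedMRT (k : ℕ) {m : ℕ} (F : TensorSumDistribution 𝕜 n m) :
    𝓓'(nonzeroDirections n, 𝕜) :=
  ∑ p : Fin (m + 1), momentumRayTransform k (F p)

end MomentumRayTransform

/-!
Contract `F` with a direction `ξ` to a single compactly supported distribution `F_ξ`, of degree at
most `m` in `ξ`. Integrating over a line `x + ℝξ` expresses the pairing of `F_ξ` with ridge
polynomials: for `v ⊥ ξ`, the function `⟪ξ, x⟫ ^ k * ⟪v, x⟫ ^ l` is a combination of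
`t ^ j * H_j (x - tξ)` with `j ≤ k`, by expanding `‖ξ‖² t + ⟪ξ, x - tξ⟫ = ⟪ξ, x⟫`. Hence the
transforms `I^{m,0} F, …, I^{m,m} F` vanish only if `F_ξ` annihilates these ridge polynomials for
all `k ≤ m`.

Expand `⟪y, x⟫ ^ l` along the decomposition of `y` into its components parallel and orthogonal to
`ξ`. The terms that survive the pairing with `F_ξ` contain `⟪ξ, x⟫ ^ k` with `k > m`, and these
carry the factor `⟪y, ξ⟫ ^ k`. On a line `ξ = η + sw` with `η ⊥ y`, `η ≠ 0` (this needs `n ≥ 2`),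
the pairing is a polynomial in `s` of degree at most `m` that is `O(s ^ (m + 1))` at `s = 0`, so it
vanishes. Powers of linear forms span all polynomials, which are dense in `C^∞(ℝⁿ)`, so `F_ξ = 0`
for every `ξ`. A polynomial in `ξ` determines its homogeneous parts and their symmetric
coefficients, which gives `F = 0`.
-/

/-! ### Symmetric tensors and polynomials -/

section TensorPolynomial

open MvPolynomial

variable {σ R : Type*} {p : ℕ}

theorem exists_perm_comp_eq_of_sum_single_eq {ι : Type*} [Fintype ι] {f g : ι → σ}
    (h : ∑ j, Finsupp.single (f j) 1 = ∑ j, Finsupp.single (g j) 1) :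
    ∃ τ : Equiv.Perm ι, g ∘ τ = f := by
  classical
  have hcard : ∀ a, Fintype.card {j // f j = a} = Fintype.card {j // g j = a} := fun a => by
    simpa [Fintype.card_subtype, Finsupp.finsetSum_apply, Finsupp.single_apply] using
      DFunLike.congr_fun h a
  exact ⟨Equiv.ofFiberEquiv fun a => Fintype.equivOfCardEq (hcard a),
    funext fun j => Equiv.ofFiberEquiv_map _ j⟩

theorem prod_X_eq_monomial [CommSemiring R] {ι : Type*} [Fintype ι] (i : ι → σ) :
    (∏ j, X (i j) : MvPolynomial σ R) = monomial (∑ j, Finsupp.single (i j) 1) 1 := by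
  simp only [monomial_sum_one, X]

theorem exists_monomial_eq_prod_X [CommSemiring R] (d : σ →₀ ℕ) :
    ∃ (l : ℕ) (i : Fin l → σ), monomial d (1 : R) = ∏ j, X (i j) := by
  classical
  refine ⟨_, d.toMultiset.toList.get, ?_⟩
  rw [prod_X_eq_monomial]
  congr 2
  apply Finsupp.orderIsoMultiset.injective
  simp only [Finsupp.coe_orderIsoMultiset, map_sum, Finsupp.toMultiset_single, one_nsmul,
    List.get_eq_getElem, Fin.sum_univ_fun_getElem _ fun a => ({a} : Multiset σ)]
  rw [← Multiset.sum_coe, ← Multiset.map_coe, Multiset.coe_toList, Multiset.sum_map_singleton]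

variable {𝕜 : Type*} [RCLike 𝕜]

theorem eq_zero_of_eval_ofReal_eq_zero {P : MvPolynomial σ 𝕜}
    (h : ∀ v : σ → ℝ, eval (fun a => (v a : 𝕜)) P = 0) : P = 0 := by
  refine funext_set (fun _ => Set.range (RCLike.ofReal : ℝ → 𝕜))
    (fun _ => Set.infinite_range_of_injective RCLike.ofReal_injective) fun x hx => ?_
  choose v hv using fun a => hx a (Set.mem_univ a)
  simpa [hv] using h v

variable [Fintype σ]

/-- The polynomial `∑ T_{i₁ ⋯ iₚ} X_{i₁} ⋯ X_{iₚ}` associated with a tensor `T` of rank `p`. -/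
noncomputable def tensorPolynomial [CommSemiring R] (T : (Fin p → σ) → R) : MvPolynomial σ R :=
  ∑ i, C (T i) * ∏ j, X (i j)

theorem isHomogeneous_tensorPolynomial [CommSemiring R] (T : (Fin p → σ) → R) :
    (tensorPolynomial T).IsHomogeneous p :=
  IsHomogeneous.sum _ _ _ fun i _ => by
    simpa using (isHomogeneous_C σ (T i)).mul
      (IsHomogeneous.prod Finset.univ _ _ fun j _ => isHomogeneous_X R (i j))

theorem coeff_tensorPolynomial [CommSemiring R] {T : (Fin p → σ) → R}
    (hT : ∀ (τ : Equiv.Perm (Fin p)) (i : Fin p → σ), T (i ∘ τ) = T i) (i : Fin p → σ) :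
    ∃ N : ℕ, N ≠ 0 ∧ (tensorPolynomial T).coeff (∑ j, Finsupp.single (i j) 1) = N * T i := by
  classical
  refine ⟨Finset.card {i' : Fin p → σ | ∑ j, Finsupp.single (i' j) 1 =
    ∑ j, Finsupp.single (i j) 1}, Finset.card_ne_zero_of_mem (a := i) (by simp), ?_⟩
  simp only [tensorPolynomial, coeff_sum, prod_X_eq_monomial, coeff_C_mul, coeff_monomial,
    mul_ite, mul_one, mul_zero, ← Finset.sum_filter]
  rw [← nsmul_eq_mul]
  refine Finset.sum_eq_card_nsmul fun i' hi' => ?_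
  obtain ⟨τ, rfl⟩ := exists_perm_comp_eq_of_sum_single_eq (Finset.mem_filter.1 hi').2
  exact hT τ i

theorem eq_zero_of_tensorPolynomial_eq_zero [CommRing R] [IsDomain R] [CharZero R]
    {T : (Fin p → σ) → R}
    (hT : ∀ (τ : Equiv.Perm (Fin p)) (i : Fin p → σ), T (i ∘ τ) = T i)
    (h : tensorPolynomial T = 0) : T = 0 := by
  funext i
  obtain ⟨N, hN, hcoeff⟩ := coeff_tensorPolynomial hT i
  rw [h, coeff_zero, zero_eq_mul] at hcoeff
  exact hcoeff.resolve_left (Nat.cast_ne_zero.2 hN)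

theorem eq_zero_of_sum_tensorPolynomial_eq_zero [CommRing R] [IsDomain R] [CharZero R] {m : ℕ}
    {T : ∀ p : Fin (m + 1), (Fin p → σ) → R}
    (hT : ∀ (p : Fin (m + 1)) (τ : Equiv.Perm (Fin p)) (i : Fin p → σ), T p (i ∘ τ) = T p i)
    (h : ∑ p, tensorPolynomial (T p) = 0) (p : Fin (m + 1)) : T p = 0 := by
  refine eq_zero_of_tensorPolynomial_eq_zero (hT p) ?_
  have hp := congrArg (homogeneousComponent (p : ℕ)) h
  simp only [map_sum, map_zero] at hp
  rw [Finset.sum_eq_single p] at hp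
  · rwa [homogeneousComponent_of_mem (isHomogeneous_tensorPolynomial _), if_pos rfl] at hp
  · intro q _ hq
    rw [homogeneousComponent_of_mem (isHomogeneous_tensorPolynomial _),
      if_neg (by simpa [Fin.ext_iff] using hq.symm)]
  · simp

theorem eval_ofReal_tensorPolynomial (T : (Fin p → σ) → 𝕜) (v : σ → ℝ) :
    eval (fun a => (v a : 𝕜)) (tensorPolynomial T) = ∑ i, (∏ j, v (i j)) • T i := by
  simp [tensorPolynomial, RCLike.real_smul_eq_coe_mul, mul_comm]

/-- The linear form `∑ vₐ Xₐ` as a polynomial. -/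
noncomputable def linForm [CommSemiring R] : (σ → R) →ₗ[R] MvPolynomial σ R :=
  Fintype.linearCombination R X

theorem linForm_apply [CommSemiring R] (v : σ → R) : linForm v = ∑ a, v a • X a :=
  Fintype.linearCombination_apply R X v

theorem eval_linForm [CommSemiring R] (v x : σ → R) : eval x (linForm v) = ∑ a, v a * x a := by
  simp [linForm_apply, smul_eval]

/-- Polarization: the values `L (X_{i₁} ⋯ X_{iₗ})` form a symmetric tensor, whose polynomial
takes the value `L (linForm y ^ l)` at `y`. -/
theorem linearMap_eq_zero_of_linForm_pow (L : MvPolynomial σ ℝ →ₗ[ℝ] 𝕜)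
    (h : ∀ (y : σ → ℝ) (l : ℕ), L (linForm y ^ l) = 0) : L = 0 := by
  have hprod (l : ℕ) : (fun i : Fin l → σ => L (∏ j, X (i j))) = 0 := by
    refine eq_zero_of_tensorPolynomial_eq_zero
      (fun τ i => congrArg L (Equiv.prod_comp τ fun j => X (i j)))
      (eq_zero_of_eval_ofReal_eq_zero fun y => ?_)
    rw [eval_ofReal_tensorPolynomial, ← h y l, linForm_apply, Fintype.sum_pow, map_sum]
    refine Finset.sum_congr rfl fun i _ => ?_
    rw [Finset.prod_smul, map_smul]
  refine linearMap_ext fun d => LinearMap.ext_ring ?_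
  obtain ⟨l, i, hi⟩ := exists_monomial_eq_prod_X (R := ℝ) d
  simpa [hi] using congrFun (hprod l) i

end TensorPolynomial

/-! ### Polynomials with continuous coefficients -/

section ContinuousCoefficients

open MvPolynomial

variable {σ Z : Type*} [TopologicalSpace Z]

/-- The value at `z` of a polynomial whose coefficients are continuous functions of `z`. -/
noncomputable def specialize (z : Z) : MvPolynomial σ C(Z, ℝ) →+* MvPolynomial σ ℝ :=
  map (ContinuousMap.evalAlgHom ℝ ℝ z)

theorem specialize_C (z : Z) (f : C(Z, ℝ)) : specialize (σ := σ) z (C f) = C (f z) :=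
  map_C _ _

theorem specialize_X (z : Z) (a : σ) : specialize z (X a) = X a :=
  map_X _ _

theorem specialize_linForm [Fintype σ] (z : Z) (f : σ → C(Z, ℝ)) :
    specialize z (linForm f) = linForm fun a => f a z := by
  simp only [linForm_apply, smul_eq_C_mul, map_sum, map_mul, specialize_C, specialize_X]

theorem specialize_eq_sum (z : Z) (Q : MvPolynomial σ C(Z, ℝ)) :
    specialize z Q = ∑ d ∈ Q.support, Q.coeff d z • monomial d 1 := by
  conv_lhs => rw [Q.as_sum, map_sum]
  simp [specialize, map_monomial, smul_monomial]

variable {W : Type*} [NormedAddCommGroup W] [NormedSpace ℝ W]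

theorem continuous_map_specialize {L : Z → MvPolynomial σ ℝ →ₗ[ℝ] W}
    (hL : ∀ q, Continuous fun z => L z q) (Q : MvPolynomial σ C(Z, ℝ)) :
    Continuous fun z => L z (specialize z Q) := by
  simp only [specialize_eq_sum, map_sum, map_smul]
  exact continuous_finsetSum _ fun d _ => (map_continuous (Q.coeff d)).smul (hL _)

variable [MeasurableSpace Z] {μ : Measure Z}

/-- The polynomial `∫ b(z) Q_z dμ(z)`, integrated coefficientwise. -/
noncomputable def integralPolynomial (μ : Measure Z) (b : Z → ℝ) (Q : MvPolynomial σ C(Z, ℝ)) :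
    MvPolynomial σ ℝ :=
  ∑ d ∈ Q.support, (∫ z, b z * Q.coeff d z ∂μ) • monomial d 1

theorem map_integralPolynomial [OpensMeasurableSpace Z] [IsFiniteMeasureOnCompacts μ]
    [CompleteSpace W] (L : MvPolynomial σ ℝ →ₗ[ℝ] W) (Q : MvPolynomial σ C(Z, ℝ)) {b : Z → ℝ}
    (hb : Continuous b) (hbc : HasCompactSupport b) :
    L (integralPolynomial μ b Q) = ∫ z, b z • L (specialize z Q) ∂μ := by
  have hint (d : σ →₀ ℕ) : Integrable (fun z => b z * Q.coeff d z) μ :=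
    (hb.mul (map_continuous (Q.coeff d))).integrable_of_hasCompactSupport hbc.mul_right
  simp only [integralPolynomial, specialize_eq_sum, map_sum, map_smul, Finset.smul_sum, smul_smul]
  rw [integral_finsetSum _ fun d _ => (hint d).smul_const _]
  simp only [integral_smul_const]

end ContinuousCoefficients

/-! ### Polynomial test functions -/

section PolynomialTestFunctions

variable {n : ℕ}

/-- The smooth function defined by a polynomial in the coordinates. -/
noncomputable def polyFun (n : ℕ) : MvPolynomial (Fin n) ℝ →ₗ[ℝ] SmoothFun n where
  toFun q := ⟨fun x => MvPolynomial.eval x q, by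
    change ContDiff ℝ ∞ _
    simp only [MvPolynomial.eval_eq]
    fun_prop⟩
  map_add' p q := Subtype.ext (funext fun x => map_add (MvPolynomial.eval x) p q)
  map_smul' c q := Subtype.ext (funext fun x => MvPolynomial.smul_eval x q c)

theorem eval_linForm_eq_inner (v x : EuclideanSpace ℝ (Fin n)) :
    MvPolynomial.eval ⇑x (linForm v) = inner ℝ v x := by
  simp [eval_linForm, PiLp.inner_apply, mul_comm]

end PolynomialTestFunctions

/-! ### Contraction with a direction -/

section Contraction

variable {𝕜 : Type*} [RCLike 𝕜] {n m : ℕ}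

/-- The contraction `∑_p ∑_{i₁, …, iₚ} ξ^{i₁} ⋯ ξ^{iₚ} f^{(p)}_{i₁ ⋯ iₚ}` of
`F = f^{(0)} + ⋯ + f^{(m)}` with the direction `ξ`, the integrand of the transforms `I^{m,k} F`. -/
noncomputable def contraction (F : TensorSumDistribution 𝕜 n m) (ξ : EuclideanSpace ℝ (Fin n)) :
    CompactDistribution 𝕜 n :=
  ∑ p : Fin (m + 1), ∑ i : Fin p → Fin n, (∏ j, ξ (i j)) • (F p).1 i

theorem contraction_apply (F : TensorSumDistribution 𝕜 n m) (ξ : EuclideanSpace ℝ (Fin n))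
    (φ : SmoothFun n) :
    (contraction F ξ).1 φ =
      ∑ p : Fin (m + 1), ∑ i : Fin p → Fin n, (∏ j, ξ (i j)) • ((F p).1 i).1 φ := by
  simp [contraction]

theorem continuous_contraction (F : TensorSumDistribution 𝕜 n m) (φ : SmoothFun n) :
    Continuous fun ξ => (contraction F ξ).1 φ := by
  simp only [contraction_apply]
  fun_prop

/-- The polynomial `ξ ↦ ⟨contraction F ξ, φ⟩`. -/
noncomputable def contractionPolynomial (F : TensorSumDistribution 𝕜 n m) (φ : SmoothFun n) :
    MvPolynomial (Fin n) 𝕜 :=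
  ∑ p, tensorPolynomial fun i => ((F p).1 i).1 φ

theorem eval_contractionPolynomial (F : TensorSumDistribution 𝕜 n m) (φ : SmoothFun n)
    (ξ : EuclideanSpace ℝ (Fin n)) :
    MvPolynomial.eval (fun a => (ξ a : 𝕜)) (contractionPolynomial F φ) =
      (contraction F ξ).1 φ := by
  simp only [contractionPolynomial, map_sum, eval_ofReal_tensorPolynomial, contraction_apply]

theorem totalDegree_contractionPolynomial_le (F : TensorSumDistribution 𝕜 n m)
    (φ : SmoothFun n) : (contractionPolynomial F φ).totalDegree ≤ m :=
  MvPolynomial.totalDegree_finsetSum_le fun p _ =>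
    (isHomogeneous_tensorPolynomial _).totalDegree_le.trans (Fin.is_le p)

theorem exists_polynomial_eval_eq_contraction (F : TensorSumDistribution 𝕜 n m) (φ : SmoothFun n)
    (v w : EuclideanSpace ℝ (Fin n)) :
    ∃ P : Polynomial 𝕜, P.natDegree ≤ m ∧
      ∀ s : ℝ, P.eval (s : 𝕜) = (contraction F (v + s • w)).1 φ := by
  refine ⟨MvPolynomial.aeval (fun a => .C (v a : 𝕜) + .X * .C (w a : 𝕜))
    (contractionPolynomial F φ), ?_, fun s => ?_⟩
  · refine (MvPolynomial.aeval_natDegree_le _ (totalDegree_contractionPolynomial_le F φ) _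
      (n := 1) fun a => ?_).trans_eq (mul_one m)
    compute_degree
  · rw [← eval_contractionPolynomial, ← Polynomial.coe_aeval_eq_eval, ← AlgHom.comp_apply,
      MvPolynomial.comp_aeval, ← MvPolynomial.coe_aeval_eq_eval]
    simp [mul_comm (s : 𝕜)]

theorem eq_zero_of_contraction_eq_zero {F : TensorSumDistribution 𝕜 n m}
    (h : ∀ ξ, contraction F ξ = 0) : F = 0 := by
  refine funext fun p => Subtype.ext (funext fun i => Subtype.ext (LinearMap.ext fun φ => ?_))
  have hsymm (p : Fin (m + 1)) (τ : Equiv.Perm (Fin p)) (i : Fin p → Fin n) :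
      ((F p).1 (i ∘ τ)).1 φ = ((F p).1 i).1 φ := by
    rw [(F p).2 τ i]
  have hpoly : contractionPolynomial F φ = 0 := eq_zero_of_eval_ofReal_eq_zero fun v =>
    (eval_contractionPolynomial F φ (WithLp.toLp 2 v)).trans (by simp [h])
  exact congrFun (eq_zero_of_sum_tensorPolynomial_eq_zero hsymm hpoly p) i

end Contraction

/-! ### Ridge polynomials -/

section Ridge

variable {V : Type*} [NormedAddCommGroup V] [InnerProductSpace ℝ V]

/-- The multiple `‖ξ‖² y - ⟪y, ξ⟫ ξ` of the component of `y` orthogonal to `ξ`, which in contrast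
to the component itself depends polynomially on `ξ`. -/
noncomputable def perp (y ξ : V) : V :=
  ‖ξ‖ ^ 2 • y - inner ℝ y ξ • ξ

theorem inner_perp_self (y ξ : V) : inner ℝ (perp y ξ) ξ = 0 := by
  rw [perp, inner_sub_left, inner_smul_left, inner_smul_left, real_inner_self_eq_norm_sq]
  exact sub_eq_zero.2 (mul_comm _ _)

theorem contDiff_perp (y : V) : ContDiff ℝ ∞ (perp y) :=
  ((contDiff_norm_sq ℝ).smul contDiff_const).sub
    ((contDiff_const.inner ℝ contDiff_id).smul contDiff_id)

variable {n : ℕ}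

/-- The polynomials `⟪f z, x⟫` in `x`, with coefficients continuous in `z`. -/
noncomputable def linFormFamily {Z : Type*} [TopologicalSpace Z]
    (f : C(Z, EuclideanSpace ℝ (Fin n))) : MvPolynomial (Fin n) C(Z, ℝ) :=
  linForm fun a => ⟨fun z => f z a, by fun_prop⟩

/-- The polynomials `⟪ξ, x⟫ ^ k * ⟪perp y ξ, x⟫ ^ l` in `x`, with coefficients continuous
in `ξ`. -/
noncomputable def ridgeFamily (y : EuclideanSpace ℝ (Fin n)) (k l : ℕ) :
    MvPolynomial (Fin n) C(EuclideanSpace ℝ (Fin n), ℝ) :=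
  linFormFamily (.id _) ^ k * linFormFamily ⟨perp y, (contDiff_perp y).continuous⟩ ^ l

theorem specialize_ridgeFamily (y ξ : EuclideanSpace ℝ (Fin n)) (k l : ℕ) :
    specialize ξ (ridgeFamily y k l) = linForm ξ ^ k * linForm ⇑(perp y ξ) ^ l := by
  simp only [ridgeFamily, linFormFamily, map_mul, map_pow, specialize_linForm]
  rfl

theorem norm_sq_pow_smul_linForm_pow (y ξ : EuclideanSpace ℝ (Fin n)) (l : ℕ) :
    (‖ξ‖ ^ 2) ^ l • linForm y ^ l = ∑ j ∈ Finset.range (l + 1),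
      (inner ℝ y ξ ^ j * l.choose j) • specialize ξ (ridgeFamily y j (l - j)) := by
  have hy : ‖ξ‖ ^ 2 • linForm (R := ℝ) y = inner ℝ y ξ • linForm ξ + linForm ⇑(perp y ξ) := by
    simp only [← map_smul, ← map_add, perp, WithLp.ofLp_sub, WithLp.ofLp_smul, add_sub_cancel]
  rw [← smul_pow, hy, add_pow]
  refine Finset.sum_congr rfl fun j _ => ?_
  rw [specialize_ridgeFamily, smul_pow, mul_smul, Nat.cast_smul_eq_nsmul, nsmul_eq_mul]
  simp only [MvPolynomial.smul_eq_C_mul]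
  ring

variable {W : Type*} [NormedAddCommGroup W] [NormedSpace ℝ W] {m : ℕ}

theorem exists_pow_smul_eq_inner_pow_smul
    {L : EuclideanSpace ℝ (Fin n) → MvPolynomial (Fin n) ℝ →ₗ[ℝ] W}
    (hL : ∀ q, Continuous fun ξ => L ξ q) {y : EuclideanSpace ℝ (Fin n)}
    (hridge : ∀ ξ ≠ 0, ∀ k ≤ m, ∀ l, L ξ (specialize ξ (ridgeFamily y k l)) = 0) (l : ℕ) :
    ∃ g : EuclideanSpace ℝ (Fin n) → W, Continuous g ∧
      ∀ ξ ≠ 0, (‖ξ‖ ^ 2) ^ l • L ξ (linForm y ^ l) = inner ℝ y ξ ^ (m + 1) • g ξ := by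
  refine ⟨fun ξ => ∑ j ∈ Finset.range (l + 1), (inner ℝ y ξ ^ (j - (m + 1)) * l.choose j) •
    L ξ (specialize ξ (ridgeFamily y j (l - j))), ?_, fun ξ hξ => ?_⟩
  · exact continuous_finsetSum _ fun j _ =>
      Continuous.smul (by fun_prop) (continuous_map_specialize hL _)
  · rw [← map_smul, norm_sq_pow_smul_linForm_pow, map_sum, Finset.smul_sum]
    refine Finset.sum_congr rfl fun j _ => ?_
    rcases le_or_gt j m with hj | hj
    · rw [map_smul, hridge ξ hξ j hj, smul_zero, smul_zero, smul_zero]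
    · rw [map_smul, smul_smul, ← mul_assoc, ← pow_add, Nat.add_sub_cancel' hj]

end Ridge

/-! ### From ridge polynomials to all polynomials -/

section Lines

open Asymptotics Filter Topology

variable {𝕜 : Type*} [RCLike 𝕜] {n m : ℕ}

theorem polynomial_eq_zero_of_isBigO {P : Polynomial 𝕜} {N : ℕ} (hdeg : P.natDegree < N)
    (hO : (fun s : ℝ => P.eval (s : 𝕜)) =O[𝓝[≠] 0] fun s => s ^ N) : P = 0 := by
  by_contra hP
  obtain ⟨Q, hPQ, hQ⟩ := P.exists_eq_pow_rootMultiplicity_mul_and_not_dvd hP 0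
  set k := P.rootMultiplicity 0
  have hk : k < N := by
    have hle := Polynomial.natDegree_le_of_dvd (P.pow_rootMultiplicity_dvd 0) hP
    rw [(Polynomial.monic_X_sub_C 0).natDegree_pow, Polynomial.natDegree_X_sub_C, mul_one] at hle
    exact hle.trans_lt hdeg
  have hQO : (fun s : ℝ => Q.eval (s : 𝕜)) =O[𝓝[≠] 0] fun s => s ^ (N - k) := by
    have hdiv := (isBigO_refl (fun s : ℝ => (s ^ k)⁻¹) (𝓝[≠] 0)).smul hO
    refine hdiv.congr' ?_ ?_ <;> filter_upwards [self_mem_nhdsWithin] with s hs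
    · have hs' : (s : 𝕜) ≠ 0 := RCLike.ofReal_ne_zero.2 hs
      rw [hPQ]
      simp [RCLike.real_smul_eq_coe_mul, hs']
    · rw [smul_eq_mul, pow_sub₀ s hs hk.le, mul_comm]
  have hlim : Tendsto (fun s : ℝ => Q.eval (s : 𝕜)) (𝓝[≠] 0) (𝓝 0) :=
    hQO.trans_tendsto (((continuous_pow (N - k)).tendsto' 0 0
      (zero_pow (Nat.sub_ne_zero_of_lt hk))).mono_left nhdsWithin_le_nhds)
  have hcont : Tendsto (fun s : ℝ => Q.eval (s : 𝕜)) (𝓝[≠] 0) (𝓝 (Q.eval 0)) :=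
    ((Q.continuous.comp RCLike.continuous_ofReal).tendsto' 0 _ (by simp)).mono_left
      nhdsWithin_le_nhds
  exact hQ (Polynomial.dvd_iff_isRoot.2 (tendsto_nhds_unique hcont hlim))

theorem exists_ne_zero_inner_eq_zero {V : Type*} [NormedAddCommGroup V] [InnerProductSpace ℝ V]
    (hV : 2 ≤ Module.finrank ℝ V) (y : V) :
    ∃ η : V, η ≠ 0 ∧ inner ℝ y η = 0 := by
  have : FiniteDimensional ℝ V := Module.finite_of_finrank_pos (by omega)
  have hker : (innerₗ V y).ker ≠ ⊥ :=
    LinearMap.ker_ne_bot_of_finrank_lt (by rw [Module.finrank_self]; omega)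
  obtain ⟨η, hηy, hη⟩ := Submodule.exists_mem_ne_zero_of_ne_bot hker
  exact ⟨η, hη, hηy⟩

theorem isBigO_linForm_pow_of_ridge {W : Type*} [NormedAddCommGroup W] [NormedSpace ℝ W]
    {L : EuclideanSpace ℝ (Fin n) → MvPolynomial (Fin n) ℝ →ₗ[ℝ] W}
    (hL : ∀ q, Continuous fun ξ => L ξ q) {y : EuclideanSpace ℝ (Fin n)}
    (hridge : ∀ ξ ≠ 0, ∀ k ≤ m, ∀ l, L ξ (specialize ξ (ridgeFamily y k l)) = 0)
    {η : EuclideanSpace ℝ (Fin n)} (hη : η ≠ 0) (hyη : inner ℝ y η = 0)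
    (w : EuclideanSpace ℝ (Fin n)) (l : ℕ) :
    (fun s : ℝ => L (η + s • w) (linForm y ^ l)) =O[𝓝[≠] 0] fun s => s ^ (m + 1) := by
  obtain ⟨g, hg, hLg⟩ := exists_pow_smul_eq_inner_pow_smul hL hridge l
  have hline : ContinuousAt (fun s : ℝ => η + s • w) 0 := by fun_prop
  have hline_ne : ∀ᶠ s : ℝ in 𝓝[≠] 0, η + s • w ≠ 0 :=
    (hline.eventually_ne (by simpa using hη)).filter_mono nhdsWithin_le_nhds
  let h (s : ℝ) : W :=
    ((‖η + s • w‖ ^ 2) ^ l)⁻¹ • inner ℝ y w ^ (m + 1) • g (η + s • w)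
  have hh : Tendsto h (𝓝[≠] 0) (𝓝 (h 0)) := by
    refine Tendsto.mono_left (ContinuousAt.smul ?_ (by fun_prop)) nhdsWithin_le_nhds
    exact ContinuousAt.inv₀ (by fun_prop) (by simp [hη])
  refine ((isBigO_refl (fun s : ℝ => s ^ (m + 1)) _).smul (hh.isBigO_one ℝ)).congr' ?_
    (.of_eq (by simp))
  filter_upwards [hline_ne] with s hs
  have hinner : inner ℝ y (η + s • w) = s * inner ℝ y w := by
    rw [inner_add_right, inner_smul_right, hyη, zero_add]
  have hnorm : (‖η + s • w‖ ^ 2) ^ l ≠ 0 := by positivity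
  rw [smul_comm, ← mul_smul (s ^ (m + 1)), ← mul_pow, ← hinner, ← hLg _ hs, inv_smul_smul₀ hnorm]

theorem contraction_linForm_pow_eq_zero (hn : 2 ≤ n) {F : TensorSumDistribution 𝕜 n m}
    {y : EuclideanSpace ℝ (Fin n)}
    (hridge : ∀ ξ ≠ 0, ∀ k ≤ m, ∀ l,
      (contraction F ξ).1 (polyFun n (specialize ξ (ridgeFamily y k l))) = 0)
    (l : ℕ) (ξ : EuclideanSpace ℝ (Fin n)) :
    (contraction F ξ).1 (polyFun n (linForm y ^ l)) = 0 := by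
  obtain ⟨η, hη, hyη⟩ := exists_ne_zero_inner_eq_zero (by simpa using hn) y
  obtain ⟨P, hPdeg, hP⟩ := exists_polynomial_eval_eq_contraction F (polyFun n (linForm y ^ l))
    η (ξ - η)
  have hO := isBigO_linForm_pow_of_ridge (L := fun ξ => (contraction F ξ).1 ∘ₗ polyFun n)
    (fun q => continuous_contraction F (polyFun n q)) hridge hη hyη (ξ - η) l
  have hP0 : P = 0 :=
    polynomial_eq_zero_of_isBigO (Nat.lt_succ_of_le hPdeg) (hO.congr_left fun s => (hP s).symm)
  simpa [hP0] using (hP 1).symm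

end Lines

/-! ### Density of polynomials in the smooth functions -/

section Landau

open Filter
open scoped Convolution

universe u

variable {V : Type u} [NormedAddCommGroup V] [InnerProductSpace ℝ V] [FiniteDimensional ℝ V]

theorem exists_smooth_cutoff (R : ℝ) :
    ∃ χ : V → ℝ, ContDiff ℝ ∞ χ ∧ HasCompactSupport χ ∧ ∀ x, ‖x‖ ≤ R → χ x = 1 := by
  let f : ContDiffBump (0 : V) := ⟨|R| + 1, |R| + 2, by positivity, by linarith⟩
  exact ⟨f, f.contDiff, f.hasCompactSupport, fun x hx => f.one_of_mem_closedBall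
    (mem_closedBall_zero_iff.2 (hx.trans ((le_abs_self R).trans (by simp [f]))))⟩

variable [MeasurableSpace V] [BorelSpace V]

/-- The normalized Landau kernel on the ball of radius `R`, an approximate identity as `s → ∞`
which is polynomial inside that ball. -/
noncomputable def landauKernel (R : ℝ) (s : ℕ) : V → ℝ :=
  (Metric.closedBall 0 R).indicator fun z =>
    (∫ w in Metric.closedBall (0 : V) R, (1 - ‖w‖ ^ 2 / R ^ 2) ^ s)⁻¹ *
      (1 - ‖z‖ ^ 2 / R ^ 2) ^ s

theorem integrable_landauKernel (R : ℝ) (s : ℕ) : Integrable (landauKernel (V := V) R s) := by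
  rw [landauKernel, integrable_indicator_iff measurableSet_closedBall]
  exact (Continuous.continuousOn (by fun_prop)).integrableOn_compact (isCompact_closedBall _ _)

theorem landauKernel_convolution_apply {G : Type*} [NormedAddCommGroup G] [NormedSpace ℝ G]
    (R : ℝ) (s : ℕ) (g : V → G) (x : V) :
    (landauKernel R s ⋆[.lsmul ℝ ℝ] g) x =
      (∫ w in Metric.closedBall (0 : V) R, (1 - ‖w‖ ^ 2 / R ^ 2) ^ s)⁻¹ •
        ∫ z in Metric.closedBall (0 : V) R, (1 - ‖z‖ ^ 2 / R ^ 2) ^ s • g (x - z) := by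
  rw [← integral_smul, ← integral_indicator measurableSet_closedBall, convolution_def]
  congr with z
  by_cases hz : z ∈ Metric.closedBall (0 : V) R
  · simp [landauKernel, hz, mul_smul]
  · simp [landauKernel, hz]

theorem eventually_norm_landauKernel_convolution_sub_le {G : Type*} [NormedAddCommGroup G]
    [NormedSpace ℝ G] [CompleteSpace G] {R : ℝ} (hR : 0 < R) {g : V → G} (hg : Continuous g)
    {K : Set V} (hK : IsCompact K) {ε : ℝ} (hε : 0 < ε) :
    ∀ᶠ s in atTop, ∀ x ∈ K, ‖(landauKernel R s ⋆[.lsmul ℝ ℝ] g) x - g x‖ ≤ ε := by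
  have := isCompact_iff_compactSpace.1 hK
  let Φ : C(V, C(K, G)) := ContinuousMap.curry ⟨fun q => g (q.2 - q.1), by fun_prop⟩
  have hball := isCompact_closedBall (0 : V) R
  have hlim := tendsto_setIntegral_pow_smul_of_unique_maximum_of_isCompact_of_continuousOn
    (μ := volume) (x₀ := (0 : V)) (g := Φ) (c := fun z => 1 - ‖z‖ ^ 2 / R ^ 2) hball
    (Continuous.continuousOn (by fun_prop))
    (fun y _ hy => by
      have := norm_pos_iff.2 hy
      simpa using (by positivity : 0 < ‖y‖ ^ 2 / R ^ 2))
    (fun y hy => by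
      have : ‖y‖ ≤ R := mem_closedBall_zero_iff.1 hy
      rw [sub_nonneg, div_le_one (by positivity)]
      gcongr)
    (by simp) (by rw [interior_closedBall _ hR.ne', closure_ball _ hR.ne']; simp [hR.le])
    Φ.continuous.continuousOn
  filter_upwards [Metric.tendsto_nhds.1 hlim ε hε] with s hs x hx
  rw [dist_eq_norm] at hs
  refine le_of_eq_of_le (congrArg norm ?_)
    ((ContinuousMap.norm_coe_le_norm _ (⟨x, hx⟩ : K)).trans hs.le)
  have hint : IntegrableOn (fun z => (1 - ‖z‖ ^ 2 / R ^ 2) ^ s • Φ z) (Metric.closedBall 0 R) :=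
    (Continuous.continuousOn (by fun_prop)).integrableOn_compact hball
  have heval := (ContinuousMap.evalCLM ℝ (⟨x, hx⟩ : K)).integral_comp_comm hint
  simp only [ContinuousMap.evalCLM_apply, ContinuousMap.smul_apply] at heval
  rw [landauKernel_convolution_apply, ContinuousMap.sub_apply, ContinuousMap.smul_apply, ← heval]
  simp [Φ]

theorem eventually_norm_iteratedFDeriv_landauKernel_convolution_sub_le {R : ℝ} (hR : 0 < R)
    {K : Set V} (hK : IsCompact K) {ε : ℝ} (hε : 0 < ε) (j : ℕ) :
    ∀ {G : Type u} [NormedAddCommGroup G] [NormedSpace ℝ G] [CompleteSpace G] {g : V → G},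
      ContDiff ℝ ∞ g → HasCompactSupport g → ∀ᶠ s in atTop, ∀ x ∈ K,
        ‖iteratedFDeriv ℝ j (landauKernel R s ⋆[.lsmul ℝ ℝ] g - g) x‖ ≤ ε := by
  induction j with
  | zero =>
    intro G _ _ _ g hg _
    simpa only [norm_iteratedFDeriv_zero, Pi.sub_apply] using
      eventually_norm_landauKernel_convolution_sub_le hR hg.continuous hK hε
  | succ j ih =>
    intro G _ _ _ g hg hgc
    filter_upwards [ih (hg.fderiv_right (m := ∞) (by simp)) (hgc.fderiv ℝ)] with s hs x hx
    rw [← norm_iteratedFDeriv_fderiv]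
    convert hs x hx using 3
    funext y
    exact ((hgc.hasFDerivAt_convolution_right _ (integrable_landauKernel R s).locallyIntegrable
      (hg.of_le (by simp)) y).sub (hg.differentiable (by simp) y).hasFDerivAt).fderiv

end Landau

section Density

open Filter
open scoped Convolution

variable {n : ℕ}

/-- The polynomials in `x` that agree with `landauKernel R s (x - z)` for `‖x - z‖ ≤ R`, with
coefficients continuous in `z`. -/
noncomputable def landauPolynomial (n : ℕ) (R : ℝ) (s : ℕ) :
    MvPolynomial (Fin n) C(EuclideanSpace ℝ (Fin n), ℝ) :=
  .C (.const _
      (∫ w in Metric.closedBall (0 : EuclideanSpace ℝ (Fin n)) R, (1 - ‖w‖ ^ 2 / R ^ 2) ^ s)⁻¹) *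
    (1 - .C (.const _ (R ^ 2)⁻¹) * ∑ a, (.X a - .C ⟨fun z => z a, by fun_prop⟩) ^ 2) ^ s

theorem eval_landauPolynomial {R : ℝ} {x z : EuclideanSpace ℝ (Fin n)} (hxz : ‖x - z‖ ≤ R)
    (s : ℕ) :
    MvPolynomial.eval ⇑x (specialize z (landauPolynomial n R s)) = landauKernel R s (x - z) := by
  rw [landauKernel, Set.indicator_of_mem (mem_closedBall_zero_iff.2 hxz)]
  simp only [landauPolynomial, map_pow, map_sub, map_one, map_mul, map_sum, specialize_C,
    specialize_X, MvPolynomial.eval_C, MvPolynomial.eval_X, ContinuousMap.const_apply,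
    ContinuousMap.coe_mk, EuclideanSpace.norm_sq_eq, div_eq_inv_mul, PiLp.sub_apply,
    Real.norm_eq_abs, sq_abs]

theorem landauKernel_convolution_eq_eval {φ : EuclideanSpace ℝ (Fin n) → ℝ} (hφ : Continuous φ)
    {r₀ r₁ : ℝ} (hφr : ∀ z, r₁ < ‖z‖ → φ z = 0) (s : ℕ) {x : EuclideanSpace ℝ (Fin n)}
    (hx : ‖x‖ ≤ r₀) :
    (landauKernel (r₀ + r₁) s ⋆[.lsmul ℝ ℝ] φ) x =
      MvPolynomial.eval ⇑x (integralPolynomial volume φ (landauPolynomial n (r₀ + r₁) s)) := by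
  have hφc : HasCompactSupport φ := HasCompactSupport.intro (isCompact_closedBall 0 r₁)
    fun z hz => hφr z (by simpa using hz)
  refine Eq.trans ?_ (map_integralPolynomial (MvPolynomial.aeval ⇑x).toLinearMap _ hφ hφc).symm
  rw [convolution_lsmul_swap]
  congr with z
  by_cases hz : ‖z‖ ≤ r₁
  · have hxz : ‖x - z‖ ≤ r₀ + r₁ := (norm_sub_le x z).trans (add_le_add hx hz)
    rw [← eval_landauPolynomial hxz, smul_eq_mul, mul_comm]
    rfl
  · simp [hφr z (not_le.1 hz)]

theorem exists_polyFun_iteratedFDeriv_sub_le (φ : SmoothFun n)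
    {K : Set (EuclideanSpace ℝ (Fin n))} (hK : IsCompact K) (N : ℕ) {ε : ℝ} (hε : 0 < ε) :
    ∃ q, ∀ j ≤ N, ∀ x ∈ K, ‖iteratedFDeriv ℝ j (φ - polyFun n q).1 x‖ ≤ ε := by
  obtain ⟨r₀, hr₀, hKr₀⟩ := hK.isBounded.subset_ball_lt 0 0
  obtain ⟨χ, hχ, hχc, hχ1⟩ := exists_smooth_cutoff (V := EuclideanSpace ℝ (Fin n)) r₀
  have hχφ : ContDiff ℝ ∞ (χ * φ.1) := hχ.mul φ.2
  have hχφc : HasCompactSupport (χ * φ.1) := hχc.mul_right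
  obtain ⟨r₁, hr₁, hχφr₁⟩ := hχφc.isCompact.isBounded.subset_closedBall_lt 0 0
  have hzero (z) (hz : r₁ < ‖z‖) : (χ * φ.1) z = 0 := image_eq_zero_of_notMem_tsupport
    fun hz' => hz.not_ge (mem_closedBall_zero_iff.1 (hχφr₁ hz'))
  have happrox : ∀ᶠ s in atTop, ∀ j ∈ Finset.range (N + 1), ∀ x ∈ K, ‖iteratedFDeriv ℝ j
      (landauKernel (r₀ + r₁) s ⋆[.lsmul ℝ ℝ] (χ * φ.1) - χ * φ.1) x‖ ≤ ε :=
    (eventually_all_finset _).2 fun j _ =>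
      eventually_norm_iteratedFDeriv_landauKernel_convolution_sub_le (add_pos hr₀ hr₁) hK hε j
        hχφ hχφc
  obtain ⟨s, hs⟩ := happrox.exists
  refine ⟨integralPolynomial volume (χ * φ.1) (landauPolynomial n (r₀ + r₁) s),
    fun j hj x hx => (le_of_eq ?_).trans (hs j (Finset.mem_range_succ_iff.2 hj) x hx)⟩
  rw [← norm_neg, ← Pi.neg_apply, ← iteratedFDeriv_neg]
  refine congrArg norm (EventuallyEq.iteratedFDeriv ℝ ?_ j).eq_of_nhds
  filter_upwards [Metric.isOpen_ball.mem_nhds (hKr₀ hx)] with z hz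
  have hz : ‖z‖ ≤ r₀ := (mem_ball_zero_iff.1 hz).le
  simp only [Pi.neg_apply, Pi.sub_apply, Pi.mul_apply, hχ1 z hz, one_mul,
    landauKernel_convolution_eq_eval hχφ.continuous hzero s hz]
  exact neg_sub _ _

variable {𝕜 : Type*} [RCLike 𝕜]

theorem eq_zero_of_polyFun_eq_zero {u : CompactDistribution 𝕜 n}
    (hu : ∀ q, u.1 (polyFun n q) = 0) : u = 0 := by
  refine Subtype.ext (LinearMap.ext fun φ => ?_)
  obtain ⟨K, N, C, hK, -, hest⟩ := u.2
  have hle : ∀ ε > 0, ‖u.1 φ‖ ≤ C * ε := fun ε hε => by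
    obtain ⟨q, hq⟩ := exists_polyFun_iteratedFDeriv_sub_le φ hK N hε
    simpa [hu] using hest (φ - polyFun n q) ε hε.le hq
  have hlim : Filter.Tendsto (fun ε => C * ε) (nhdsWithin 0 (Set.Ioi 0)) (nhds 0) :=
    ((continuous_const_mul C).tendsto' 0 0 (mul_zero C)).mono_left nhdsWithin_le_nhds
  exact norm_le_zero_iff.1 (ge_of_tendsto hlim (eventually_mem_nhdsWithin.mono hle))

end Density

/-! ### Test functions with prescribed combinations of ray integrals -/

section LineIntegrals

variable {V : Type*} [NormedAddCommGroup V] [InnerProductSpace ℝ V]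

theorem norm_mul_norm_sub_smul_le (x ξ : V) (t : ℝ) :
    ‖ξ‖ * ‖x - t • ξ‖ ≤ 2 * ‖ξ‖ * ‖x‖ + |inner ℝ ξ (x - t • ξ)| := by
  have ht : inner ℝ ξ x - inner ℝ ξ (x - t • ξ) = t * ‖ξ‖ ^ 2 := by
    rw [← inner_sub_right, sub_sub_cancel, inner_smul_right, real_inner_self_eq_norm_sq]
  calc ‖ξ‖ * ‖x - t • ξ‖ ≤ ‖ξ‖ * (‖x‖ + ‖t • ξ‖) := by gcongr; exact norm_sub_le _ _
    _ = ‖ξ‖ * ‖x‖ + |inner ℝ ξ x - inner ℝ ξ (x - t • ξ)| := by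
      rw [ht, abs_mul, abs_of_nonneg (sq_nonneg ‖ξ‖), norm_smul, Real.norm_eq_abs]
      ring
    _ ≤ ‖ξ‖ * ‖x‖ + (‖ξ‖ * ‖x‖ + |inner ℝ ξ (x - t • ξ)|) := by
      gcongr
      exact (abs_sub _ _).trans (by gcongr; exact abs_real_inner_le_norm ξ x)
    _ = 2 * ‖ξ‖ * ‖x‖ + |inner ℝ ξ (x - t • ξ)| := by ring

theorem norm_sub_smul_le_of_abs_inner_le {x ξ : V} {t R δ c : ℝ} (hx : ‖x‖ ≤ R) (hδ : 0 < δ)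
    (hξ : δ ≤ ‖ξ‖) (hinner : |inner ℝ ξ (x - t • ξ)| ≤ c) : ‖x - t • ξ‖ ≤ 2 * R + c / δ := by
  have hξ0 : 0 < ‖ξ‖ := hδ.trans_le hξ
  have hc : 0 ≤ c := (abs_nonneg _).trans hinner
  calc ‖x - t • ξ‖ ≤ (2 * ‖ξ‖ * ‖x‖ + |inner ℝ ξ (x - t • ξ)|) / ‖ξ‖ := by
        rw [le_div_iff₀' hξ0]
        exact norm_mul_norm_sub_smul_le x ξ t
    _ = 2 * ‖x‖ + |inner ℝ ξ (x - t • ξ)| / ‖ξ‖ := by field_simp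
    _ ≤ 2 * R + c / δ := by gcongr

theorem integral_comp_inner_sub_smul (ρ : ℝ → ℝ) (x ξ : V) :
    ∫ t : ℝ, ρ (inner ℝ ξ (x - t • ξ)) = (‖ξ‖ ^ 2)⁻¹ * ∫ s, ρ s := by
  have hinner (t : ℝ) : inner ℝ ξ (x - t • ξ) = inner ℝ ξ x - ‖ξ‖ ^ 2 * t := by
    rw [inner_sub_right, inner_smul_right, real_inner_self_eq_norm_sq, mul_comm]
  simp only [hinner]
  rw [Measure.integral_comp_mul_left (fun s => ρ (inner ℝ ξ x - s)), integral_sub_left_eq_self]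
  simp

theorem exists_pos_le_norm_of_tsupport_subset {W : Type*} [SeminormedAddCommGroup W] {b : W → ℝ}
    (hb0 : tsupport b ⊆ {0}ᶜ) :
    ∃ δ > 0, ∀ ξ, b ξ ≠ 0 → δ ≤ ‖ξ‖ := by
  obtain ⟨δ, hδ, hball⟩ := Metric.isOpen_iff.1 (isClosed_tsupport b).isOpen_compl 0
    fun h => hb0 h rfl
  exact ⟨δ, hδ, fun ξ hξ => not_lt.1 fun h =>
    hball (mem_ball_zero_iff.2 h) (subset_tsupport b hξ)⟩

variable {n : ℕ}

theorem exists_testFunction_integral_line_eq {b : EuclideanSpace ℝ (Fin n) → ℝ}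
    (hb : ContDiff ℝ ∞ b) (hbc : HasCompactSupport b) (hb0 : tsupport b ⊆ {0}ᶜ) (R : ℝ) :
    ∃ θ : 𝓓(nonzeroDirections n, ℝ), ∀ x, ‖x‖ < R → ∀ ξ, ∫ t : ℝ, θ (x - t • ξ, ξ) = b ξ := by
  obtain ⟨δ, hδ, hδb⟩ := exists_pos_le_norm_of_tsupport_subset hb0
  let ρ : ContDiffBump (0 : ℝ) := default
  obtain ⟨χ, hχ, hχc, hχ1⟩ := exists_smooth_cutoff (V := EuclideanSpace ℝ (Fin n))
    (2 * R + ρ.rOut / δ)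
  let θ : EuclideanSpace ℝ (Fin n) × EuclideanSpace ℝ (Fin n) → ℝ := fun q =>
    χ q.1 * (‖q.2‖ ^ 2 * b q.2 * ρ.normed volume (inner ℝ q.2 q.1))
  have hθ : ContDiff ℝ ∞ θ := (hχ.comp contDiff_fst).mul
    ((((contDiff_norm_sq ℝ).comp contDiff_snd).mul (hb.comp contDiff_snd)).mul
      (ρ.contDiff_normed.comp (contDiff_snd.inner ℝ contDiff_fst)))
  have hθK (q) (hq : q ∉ tsupport χ ×ˢ tsupport b) : θ q = 0 := by
    rcases not_and_or.1 hq with hq | hq <;> simp [θ, image_eq_zero_of_notMem_tsupport hq]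
  have hK := hχc.isCompact.prod hbc.isCompact
  refine ⟨⟨θ, hθ, .intro hK hθK, (closure_minimal (Function.support_subset_iff'.2 hθK)
    hK.isClosed).trans fun q hq => hb0 hq.2⟩, fun x hx ξ => ?_⟩
  change ∫ t : ℝ, θ (x - t • ξ, ξ) = b ξ
  by_cases hξ : b ξ = 0
  · simp [θ, hξ]
  have hcut (t : ℝ) : θ (x - t • ξ, ξ) =
      ‖ξ‖ ^ 2 * b ξ * ρ.normed volume (inner ℝ ξ (x - t • ξ)) := by
    by_cases ht : ρ.normed volume (inner ℝ ξ (x - t • ξ)) = 0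
    · simp only [θ, ht, mul_zero]
    have hinner : |inner ℝ ξ (x - t • ξ)| < ρ.rOut := by
      simpa [ρ.support_normed_eq] using Function.mem_support.2 ht
    have hnorm := norm_sub_smul_le_of_abs_inner_le hx.le hδ (hδb ξ hξ) hinner.le
    simp only [θ, hχ1 _ hnorm, one_mul]
  have hξ0 : ‖ξ‖ ≠ 0 := (hδ.trans_le (hδb ξ hξ)).ne'
  simp only [hcut]
  rw [integral_const_mul, integral_comp_inner_sub_smul, ρ.integral_normed]
  field_simp

/-- The product of a test function with a smooth function. -/
noncomputable def testFunctionMul (θ : 𝓓(nonzeroDirections n, ℝ))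
    {H : EuclideanSpace ℝ (Fin n) × EuclideanSpace ℝ (Fin n) → ℝ} (hH : ContDiff ℝ ∞ H) :
    𝓓(nonzeroDirections n, ℝ) where
  toFun := θ * H
  contDiff' := θ.contDiff.mul hH
  hasCompactSupport' := θ.hasCompactSupport.mul_right
  tsupport_subset' := tsupport_mul_subset_left.trans θ.tsupport_subset

theorem sum_adjointMRT_testFunctionMul {θ : 𝓓(nonzeroDirections n, ℝ)}
    {H : ℕ → EuclideanSpace ℝ (Fin n) × EuclideanSpace ℝ (Fin n) → ℝ}
    (hH : ∀ j, ContDiff ℝ ∞ (H j)) {g b : EuclideanSpace ℝ (Fin n) → ℝ} {N : ℕ}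
    {x : EuclideanSpace ℝ (Fin n)}
    (hHg : ∀ ξ t, ∑ j ∈ Finset.range N, t ^ j * H j (x - t • ξ, ξ) = g ξ)
    (hθ : ∀ ξ, ∫ t : ℝ, θ (x - t • ξ, ξ) = b ξ) {p : ℕ} (i : Fin p → Fin n) :
    ∑ j ∈ Finset.range N, (adjointMRT j i (testFunctionMul θ (hH j))).1 x =
      ∫ ξ, b ξ * (∏ a, ξ (i a)) * g ξ := by
  have hint (j : ℕ) := integrable_rayIntegrand (a := fun q => q.2 ^ j * ∏ a, q.1 (i a))
    (by fun_prop) (testFunctionMul θ (hH j)).hasCompactSupport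
    (testFunctionMul θ (hH j)).tsupport_subset (testFunctionMul θ (hH j)).continuous
    (fun _ hq => image_eq_zero_of_notMem_tsupport hq) x
  have hsum (q : EuclideanSpace ℝ (Fin n) × ℝ) :
      ∑ j ∈ Finset.range N, (q.2 ^ j * ∏ a, q.1 (i a)) •
        testFunctionMul θ (hH j) (x - q.2 • q.1, q.1) =
      (∏ a, q.1 (i a)) * g q.1 * θ (x - q.2 • q.1, q.1) := by
    rw [← hHg q.1 q.2, Finset.mul_sum, Finset.sum_mul]
    refine Finset.sum_congr rfl fun j _ => ?_
    change (q.2 ^ j * ∏ a, q.1 (i a)) * (θ _ * H j _) = _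
    ring
  simp only [coe_adjointMRT, rayIntegral]
  rw [← integral_finsetSum _ fun j _ => hint j]
  have hprod := integrable_finsetSum (Finset.range N) fun j _ => hint j
  simp only [hsum] at hprod ⊢
  rw [Measure.volume_eq_prod, integral_prod _ hprod]
  simp only [integral_const_mul, hθ]
  congr with ξ
  ring

end LineIntegrals

section RidgeTestFunctions

variable {n : ℕ}

theorem inner_pow_mul_inner_perp_pow (y x ξ : EuclideanSpace ℝ (Fin n)) (k l : ℕ) (t : ℝ) :
    ∑ j ∈ Finset.range (k + 1), t ^ j * (k.choose j * (‖ξ‖ ^ 2) ^ j *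
      inner ℝ ξ (x - t • ξ) ^ (k - j) * inner ℝ (perp y ξ) (x - t • ξ) ^ l) =
        inner ℝ ξ x ^ k * inner ℝ (perp y ξ) x ^ l := by
  have hperp : inner ℝ (perp y ξ) (x - t • ξ) = inner ℝ (perp y ξ) x := by
    rw [inner_sub_right, inner_smul_right, inner_perp_self, mul_zero, sub_zero]
  have hinner : inner ℝ ξ x = t * ‖ξ‖ ^ 2 + inner ℝ ξ (x - t • ξ) := by
    rw [inner_sub_right, inner_smul_right, real_inner_self_eq_norm_sq, add_sub_cancel]
  rw [hperp, hinner, add_pow, Finset.sum_mul]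
  refine Finset.sum_congr rfl fun j _ => ?_
  ring

theorem exists_sum_adjointMRT_eq_integral_ridge {b : EuclideanSpace ℝ (Fin n) → ℝ}
    (hb : ContDiff ℝ ∞ b) (hbc : HasCompactSupport b) (hb0 : tsupport b ⊆ {0}ᶜ)
    (y : EuclideanSpace ℝ (Fin n)) (k l : ℕ) (R : ℝ) :
    ∃ ψ : ℕ → 𝓓(nonzeroDirections n, ℝ), ∀ {p : ℕ} (i : Fin p → Fin n) x, ‖x‖ < R →
      ∑ j ∈ Finset.range (k + 1), (adjointMRT j i (ψ j)).1 x =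
        ∫ ξ, b ξ * (∏ a, ξ (i a)) *
          MvPolynomial.eval ⇑x (specialize ξ (ridgeFamily y k l)) := by
  obtain ⟨θ, hθ⟩ := exists_testFunction_integral_line_eq hb hbc hb0 R
  let H (j : ℕ) (q : EuclideanSpace ℝ (Fin n) × EuclideanSpace ℝ (Fin n)) : ℝ :=
    k.choose j * (‖q.2‖ ^ 2) ^ j * inner ℝ q.2 q.1 ^ (k - j) * inner ℝ (perp y q.2) q.1 ^ l
  have hH (j : ℕ) : ContDiff ℝ ∞ (H j) :=
    ((contDiff_const.mul (((contDiff_norm_sq ℝ).comp contDiff_snd).pow j)).mul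
      ((contDiff_snd.inner ℝ contDiff_fst).pow (k - j))).mul
        ((((contDiff_perp y).comp contDiff_snd).inner ℝ contDiff_fst).pow l)
  refine ⟨fun j => testFunctionMul θ (hH j), fun i x hx => ?_⟩
  simp only [specialize_ridgeFamily, map_mul, map_pow, eval_linForm_eq_inner]
  exact sum_adjointMRT_testFunctionMul hH (fun ξ t => inner_pow_mul_inner_perp_pow y x ξ k l t)
    (hθ x hx) i

end RidgeTestFunctions

/-! ### Vanishing on ridge polynomials -/

section Vanishing

variable {𝕜 : Type*} [RCLike 𝕜] {n m : ℕ}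

theorem exists_ball_pairing_congr (u : CompactDistribution 𝕜 n) :
    ∃ R : ℝ, ∀ φ ψ : SmoothFun n, (∀ x, ‖x‖ < R → φ.1 x = ψ.1 x) → u.1 φ = u.1 ψ := by
  obtain ⟨K, N, C, hK, -, hest⟩ := u.2
  obtain ⟨R, hR⟩ := hK.isBounded.subset_ball 0
  refine ⟨R, fun φ ψ h => ?_⟩
  rw [← sub_eq_zero, ← map_sub, ← norm_le_zero_iff]
  refine (hest (φ - ψ) 0 le_rfl fun j _ x hx => ?_).trans_eq (mul_zero C)
  have hzero : (φ - ψ).1 =ᶠ[nhds x] fun _ => 0 := by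
    filter_upwards [Metric.isOpen_ball.mem_nhds (hR hx)] with z hz
    exact sub_eq_zero.2 (h z (mem_ball_zero_iff.1 hz))
  rw [(hzero.iteratedFDeriv ℝ j).eq_of_nhds, iteratedFDeriv_fun_zero, Pi.zero_apply, norm_zero]

theorem generalizedMRT_apply (k : ℕ) (F : TensorSumDistribution 𝕜 n m)
    (ψ : 𝓓(nonzeroDirections n, ℝ)) :
    generalizedMRT k F ψ =
      ∑ p : Fin (m + 1), ∑ i : Fin p → Fin n, ((F p).1 i).1 (adjointMRT k i ψ) := by
  simp only [generalizedMRT, momentumRayTransform, _root_.sum_apply]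
  rfl

theorem exists_sum_pairing_adjointMRT_eq_integral_ridge {b : EuclideanSpace ℝ (Fin n) → ℝ}
    (hb : ContDiff ℝ ∞ b) (hbc : HasCompactSupport b) (hb0 : tsupport b ⊆ {0}ᶜ)
    (F : TensorSumDistribution 𝕜 n m) (y : EuclideanSpace ℝ (Fin n)) (k l : ℕ) :
    ∃ ψ : ℕ → 𝓓(nonzeroDirections n, ℝ), ∀ (p : Fin (m + 1)) (i : Fin p → Fin n),
      ∑ j ∈ Finset.range (k + 1), ((F p).1 i).1 (adjointMRT j i (ψ j)) =
        ∫ ξ, (b ξ * ∏ a, ξ (i a)) •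
          ((F p).1 i).1 (polyFun n (specialize ξ (ridgeFamily y k l))) := by
  choose R hR using fun p i => exists_ball_pairing_congr ((F p).1 i)
  obtain ⟨R₀, hR₀⟩ := Finite.exists_le fun r : (p : Fin (m + 1)) × (Fin p → Fin n) => R r.1 r.2
  obtain ⟨ψ, hψ⟩ := exists_sum_adjointMRT_eq_integral_ridge hb hbc hb0 y k l R₀
  refine ⟨ψ, fun p i => ?_⟩
  have hbi : Continuous fun ξ : EuclideanSpace ℝ (Fin n) => b ξ * ∏ a, ξ (i a) :=
    hb.continuous.mul (by fun_prop)
  rw [← map_sum]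
  refine (hR p i _ _ fun x hx => ?_).trans
    (map_integralPolynomial (((F p).1 i).1 ∘ₗ polyFun n) _ hbi hbc.mul_right)
  refine Eq.trans ?_
    (map_integralPolynomial (MvPolynomial.aeval ⇑x).toLinearMap _ hbi hbc.mul_right).symm
  refine Eq.trans ?_ (hψ i x (hx.trans_le (hR₀ ⟨p, i⟩)))
  rw [AddSubmonoidClass.coe_finsetSum, Finset.sum_apply]

theorem exists_sum_generalizedMRT_eq_integral_ridge {b : EuclideanSpace ℝ (Fin n) → ℝ}
    (hb : ContDiff ℝ ∞ b) (hbc : HasCompactSupport b) (hb0 : tsupport b ⊆ {0}ᶜ)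
    (F : TensorSumDistribution 𝕜 n m) (y : EuclideanSpace ℝ (Fin n)) (k l : ℕ) :
    ∃ ψ : ℕ → 𝓓(nonzeroDirections n, ℝ), ∑ j ∈ Finset.range (k + 1), generalizedMRT j F (ψ j) =
      ∫ ξ, b ξ • (contraction F ξ).1 (polyFun n (specialize ξ (ridgeFamily y k l))) := by
  obtain ⟨ψ, hψ⟩ := exists_sum_pairing_adjointMRT_eq_integral_ridge hb hbc hb0 F y k l
  have hint (p : Fin (m + 1)) (i : Fin p → Fin n) : Integrable fun ξ => (b ξ * ∏ a, ξ (i a)) •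
      ((F p).1 i).1 (polyFun n (specialize ξ (ridgeFamily y k l))) :=
    ((hb.continuous.mul (by fun_prop)).smul (continuous_map_specialize
      (L := fun _ => ((F p).1 i).1 ∘ₗ polyFun n) (fun q => continuous_const) _)
        ).integrable_of_hasCompactSupport hbc.mul_right.smul_right
  refine ⟨ψ, ?_⟩
  simp only [generalizedMRT_apply, contraction_apply, Finset.smul_sum, smul_smul]
  rw [Finset.sum_comm, integral_finsetSum _ fun p _ => integrable_finsetSum _ fun i _ => hint p i]
  refine Finset.sum_congr rfl fun p _ => ?_
  rw [Finset.sum_comm, integral_finsetSum _ fun i _ => hint p i]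
  exact Finset.sum_congr rfl fun i _ => hψ p i

theorem contraction_ridge_eq_zero {F : TensorSumDistribution 𝕜 n m} {k : ℕ}
    (hF : ∀ j ≤ k, generalizedMRT j F = 0) (y : EuclideanSpace ℝ (Fin n)) (l : ℕ)
    {ξ : EuclideanSpace ℝ (Fin n)} (hξ : ξ ≠ 0) :
    (contraction F ξ).1 (polyFun n (specialize ξ (ridgeFamily y k l))) = 0 := by
  have hcont : Continuous fun ξ =>
      (contraction F ξ).1 (polyFun n (specialize ξ (ridgeFamily y k l))) :=
    continuous_map_specialize (L := fun ξ => (contraction F ξ).1 ∘ₗ polyFun n)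
      (fun q => continuous_contraction F (polyFun n q)) _
  have hae := isOpen_compl_singleton.ae_eq_zero_of_integral_contDiff_smul_eq_zero
    (hcont.locallyIntegrable.locallyIntegrableOn _) fun b hb hbc hb0 => by
      obtain ⟨ψ, hψ⟩ := exists_sum_generalizedMRT_eq_integral_ridge hb hbc hb0 F y k l
      rw [← hψ]
      exact Finset.sum_eq_zero fun j hj => by
        rw [hF j (Finset.mem_range_succ_iff.1 hj)]
        rfl
  exact Measure.eqOn_open_of_ae_eq (μ := volume) (g := fun _ => (0 : 𝕜))
    ((ae_restrict_iff' isOpen_compl_singleton.measurableSet).2 hae) isOpen_compl_singleton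
    hcont.continuousOn continuousOn_const hξ

end Vanishing

theorem mainTheorem2 {𝕜 : Type*} [RCLike 𝕜] (n m : ℕ) (hn : 2 ≤ n)
    (F : TensorSumDistribution 𝕜 n m)
    (hF : ∀ k : ℕ, k ≤ m → generalizedMRT k F = 0) : F = 0 := by
  have hridge (y ξ : EuclideanSpace ℝ (Fin n)) (hξ : ξ ≠ 0) (k : ℕ) (hk : k ≤ m) (l : ℕ) :
      (contraction F ξ).1 (polyFun n (specialize ξ (ridgeFamily y k l))) = 0 :=
    contraction_ridge_eq_zero (fun j hj => hF j (hj.trans hk)) y l hξ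
  have hpow (ξ y : EuclideanSpace ℝ (Fin n)) (l : ℕ) :
      (contraction F ξ).1 (polyFun n (linForm y ^ l)) = 0 :=
    contraction_linForm_pow_eq_zero hn (hridge y) l ξ
  have hpoly (ξ : EuclideanSpace ℝ (Fin n)) : (contraction F ξ).1 ∘ₗ polyFun n = 0 :=
    linearMap_eq_zero_of_linForm_pow _ fun y l => hpow ξ (WithLp.toLp 2 y) l
  exact eq_zero_of_contraction_eq_zero fun ξ =>
    eq_zero_of_polyFun_eq_zero (LinearMap.congr_fun (hpoly ξ))
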